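/- Let $G$ be a compact (Hausdorff) group with neutral element $e$, and let $dg$ and $d\rho$ denote integration with respect to normalized Haar measure on $G$. Let $(\mu_t,\,t\ge 0)$ be a vaguely continuous convolution semigroup of Borel probability measures on $G$ with $\mu_0=\delta_e$. Suppose that for every $t>0$ the measure $\mu_t$ is central, i.e. $\mu_t(\sigma A\sigma^{-1})=\mu_t(A)$ for all $\sigma\in G$ and all Borel sets $A$, symmetric, i.e. $\mu_t(A^{-1})=\mu_t(A)$ for all Borel sets $A$, and has a continuous density $k_t:G\to\mathbb R$ with respect to normalized Haar measure. Then for every $t>0$ $$k_t(e)\;\ge\;\int_G\int_G k_t(\rho^{-1}g\rho g^{-1})\,dg\,d\rho ,$$ and, for every $t>0$, equality holds if and only if $G$ is abelian. -/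

import Mathlib

open MeasureTheory
open scoped NNReal Pointwise

/-- Normalized Haar measure of a compact group: the regular left invariant Borel measure of total
mass one. -/
noncomputable def normalizedHaar (G : Type*) [Group G] [TopologicalSpace G] [IsTopologicalGroup G]
    [CompactSpace G] [MeasurableSpace G] [BorelSpace G] : Measure G :=
  Measure.haarMeasure ⊤

/-- `κ` is the convolution of `μ` and `ν`. On a compact group this is tested on continuous
functions; this avoids the measurability of multiplication for the product of the Borel
`σ`-algebras, which can fail when `G` is not second countable. -/
def IsConvolution {G : Type*} [Group G] [TopologicalSpace G] [MeasurableSpace G]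
    (κ μ ν : Measure G) : Prop :=
  ∀ f : C(G, ℝ), ∫ x, f x ∂κ = ∫ σ, ∫ τ, f (σ * τ) ∂ν ∂μ

/-- A vaguely continuous convolution semigroup `(μ_t, t ≥ 0)` of Borel probability measures with
`μ_0 = δ_e`. The topology on `ProbabilityMeasure G` is that of convergence of the integrals of
bounded continuous functions; on a compact group it is the vague one. -/
structure IsConvolutionSemigroup {G : Type*} [Group G] [TopologicalSpace G] [MeasurableSpace G]
    [OpensMeasurableSpace G] (μ : ℝ≥0 → ProbabilityMeasure G) : Prop where
  zero : (μ 0 : Measure G) = Measure.dirac 1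
  add : ∀ s t : ℝ≥0, IsConvolution (μ (s + t) : Measure G) (μ s : Measure G) (μ t : Measure G)
  continuous : Continuous μ

/-- Central (conjugate invariant): `μ (σ A σ⁻¹) = μ A` for all `σ` and all Borel sets `A`. -/
def IsCentralMeasure {G : Type*} [Group G] [MeasurableSpace G] (μ : Measure G) : Prop :=
  ∀ σ : G, ∀ A : Set G, MeasurableSet A → μ ((fun x => σ * x * σ⁻¹) '' A) = μ A

/-- Symmetric: `μ (A⁻¹) = μ A` for all Borel sets `A`. -/
def IsSymmetricMeasure {G : Type*} [Group G] [MeasurableSpace G] (μ : Measure G) : Prop :=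
  ∀ A : Set G, MeasurableSet A → μ A⁻¹ = μ A

/-- `k` is (a version of) the density of `μ`: `μ` is absolutely continuous with respect to
normalized Haar measure and `k` is its Radon--Nikodym derivative. -/
def HasHaarDensity {G : Type*} [Group G] [TopologicalSpace G] [IsTopologicalGroup G]
    [CompactSpace G] [MeasurableSpace G] [BorelSpace G] (μ : Measure G) (k : G → ℝ) : Prop :=
  μ ≪ normalizedHaar G ∧
    k =ᵐ[normalizedHaar G] fun σ => (μ.rnDeriv (normalizedHaar G) σ).toReal

/-!
Writing `h` for the density of `μ_{s}`, the semigroup law and symmetry give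
`k_{2s}(c) = ∫ h(y) h(y⁻¹ c) dy`, whence `∫ (h(y) - h(y⁻¹ c))² dy = 2 (k_{2s}(1) - k_{2s}(c))`.
This gives the inequality; in case of equality every commutator `c` satisfies
`k_t(c) = k_t(1)`, so `k_{t/2}` is invariant under right translation by `c`. Iterating, `μ_{t/2ⁿ}`
is invariant under `c` for all `n`, and so is its limit `δ_1`, which forces `c = 1`.
-/

open Filter Topology Measure

/-! ### Two-sided and inversion invariance of normalized Haar measure -/

section Haar

variable {G : Type*} [Group G] [TopologicalSpace G] [IsTopologicalGroup G]
  [CompactSpace G] [MeasurableSpace G] [BorelSpace G]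

/-! Since `k_t` is the convolution square of a symmetric density, it is maximal at `1`
(`IsConvolution.density_le`), so averaging it over commutators gives at most `k_t(1)`. Haar measure
charges every nonempty open set, so a continuous function whose mean equals its upper bound is
constant: equality puts every commutator where `k_t` is maximal. By
`IsConvolutionSemigroup.eq_one_of_density_eq` that set is `{1}`. -/

instance isHaarMeasure_normalizedHaar : IsHaarMeasure (normalizedHaar G) := by
  unfold normalizedHaar; infer_instance

instance isProbabilityMeasure_normalizedHaar : IsProbabilityMeasure (normalizedHaar G) := by
  constructor
  have := haarMeasure_self (G := G) (K₀ := ⊤)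
  simpa [normalizedHaar] using this

/-- A right translate is still left invariant and of mass one, and the Haar probability measure is
unique. -/
instance isMulRightInvariant_normalizedHaar : IsMulRightInvariant (normalizedHaar G) := by
  constructor
  intro g
  have : IsProbabilityMeasure (map (· * g) (normalizedHaar G)) :=
    isProbabilityMeasure_map (measurable_mul_const g).aemeasurable
  exact isHaarMeasure_eq_of_isProbabilityMeasure _ _

instance isInvInvariant_normalizedHaar : IsInvInvariant (normalizedHaar G) := by
  constructor
  have : IsProbabilityMeasure (normalizedHaar G).inv :=
    isProbabilityMeasure_map measurable_inv.aemeasurable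
  -- Left invariance of the inverted measure is right invariance of the original one.
  have : IsHaarMeasure (normalizedHaar G).inv :=
    isHaarMeasure_of_isCompact_nonempty_interior _ Set.univ isCompact_univ (by simp)
      (by simp) (by simp)
  exact isHaarMeasure_eq_of_isProbabilityMeasure _ _

end Haar

/-! ### Integrals of continuous functions on a compact space -/

section Compact

variable {X Y : Type*} [TopologicalSpace X] [TopologicalSpace Y] [CompactSpace Y]
  [MeasurableSpace Y] [BorelSpace Y]

theorem Continuous.integrable_of_compactSpace {f : Y → ℝ} (hf : Continuous f)
    (ν : Measure Y) [IsFiniteMeasureOnCompacts ν] : Integrable f ν :=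
  hf.integrable_of_hasCompactSupport (HasCompactSupport.of_compactSpace f)

theorem continuous_integral_of_compactSpace {f : X → Y → ℝ} (hf : Continuous f.uncurry)
    (ν : Measure Y) [IsFiniteMeasureOnCompacts ν] : Continuous fun x => ∫ y, f x y ∂ν := by
  rw [← continuousOn_univ]
  exact continuousOn_integral_of_compact_support isCompact_univ hf.continuousOn (by simp)

theorem Continuous.eq_zero_of_integral_eq_zero {f : Y → ℝ} (hf : Continuous f) (h0 : 0 ≤ f)
    {ν : Measure Y} [IsFiniteMeasureOnCompacts ν] [IsOpenPosMeasure ν]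
    (h : ∫ y, f y ∂ν = 0) (y : Y) : f y = 0 := by
  by_contra hy
  exact (hf.integral_pos_of_hasCompactSupport_nonneg_nonzero (μ := ν)
    (HasCompactSupport.of_compactSpace f) h0 hy).ne' h

/-- Testing with `φ = f - g` gives `∫ (f - g)² = 0`. This upgrades almost everywhere identities
between densities to pointwise ones. -/
theorem Continuous.eq_of_forall_integral_mul_eq {f g : Y → ℝ} (hf : Continuous f)
    (hg : Continuous g) {ν : Measure Y} [IsFiniteMeasureOnCompacts ν] [IsOpenPosMeasure ν]
    (h : ∀ φ : C(Y, ℝ), ∫ y, φ y * f y ∂ν = ∫ y, φ y * g y ∂ν) (y : Y) : f y = g y := by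
  have hd : Continuous fun y => f y - g y := hf.sub hg
  have key : ∫ y, (f y - g y) * (f y - g y) ∂ν = 0 := by
    have := h ⟨_, hd⟩
    simp only [ContinuousMap.coe_mk] at this
    simp_rw [mul_sub (_ - _)]
    have i1 := Continuous.integrable_of_compactSpace
      (show Continuous fun y => (f y - g y) * f y from hd.mul hf) ν
    have i2 := Continuous.integrable_of_compactSpace
      (show Continuous fun y => (f y - g y) * g y from hd.mul hg) ν
    rw [integral_sub i1 i2, this, sub_self]
  have := Continuous.eq_zero_of_integral_eq_zero (hd.mul hd) (fun y => mul_self_nonneg _) key y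
  exact sub_eq_zero.1 (mul_self_eq_zero.1 this)

/-- A continuous function bounded by `M` whose mean is `M` is constant. -/
theorem Continuous.eq_of_le_of_integral_eq {f : Y → ℝ} (hf : Continuous f) {M : ℝ}
    (hM : ∀ y, f y ≤ M) {ν : Measure Y} [IsProbabilityMeasure ν] [IsOpenPosMeasure ν]
    (h : ∫ y, f y ∂ν = M) (y : Y) : f y = M := by
  have := Continuous.eq_zero_of_integral_eq_zero (ν := ν) (f := fun y => M - f y)
    (continuous_const.sub hf) (fun y => sub_nonneg.2 (hM y))
    (by rw [integral_sub (integrable_const _) (hf.integrable_of_compactSpace ν), h]; simp) y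
  exact (sub_eq_zero.1 this).symm

theorem Continuous.integral_le_of_le {f : Y → ℝ} (hf : Continuous f) {M : ℝ}
    (hM : ∀ y, f y ≤ M) (ν : Measure Y) [IsProbabilityMeasure ν] : ∫ y, f y ∂ν ≤ M := by
  simpa using integral_mono (hf.integrable_of_compactSpace ν) (integrable_const M) hM

end Compact

/-! ### Continuous densities and their convolution squares -/

section Density

variable {G : Type*} [Group G] [TopologicalSpace G] [IsTopologicalGroup G]
  [CompactSpace G] [MeasurableSpace G] [BorelSpace G]

theorem HasHaarDensity.integral_eq {μ : Measure G} [IsFiniteMeasure μ] {h : G → ℝ}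
    (hh : HasHaarDensity μ h) (f : G → ℝ) :
    ∫ x, f x ∂μ = ∫ x, f x * h x ∂(normalizedHaar G) := by
  rw [← integral_toReal_rnDeriv_mul hh.1]
  refine integral_congr_ae ?_
  filter_upwards [hh.2] with x hx
  rw [hx, mul_comm]

theorem IsSymmetricMeasure.density_inv {μ : Measure G} [IsFiniteMeasure μ] {h : G → ℝ}
    (hμ : IsSymmetricMeasure μ) (hh : HasHaarDensity μ h) (hc : Continuous h) (x : G) :
    h x⁻¹ = h x := by
  refine Continuous.eq_of_forall_integral_mul_eq (ν := normalizedHaar G)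
    (hc.comp continuous_inv) hc (fun φ => ?_) x
  have hmap : map (fun x => x⁻¹) μ = μ := by
    ext A hA
    rw [map_apply measurable_inv hA]
    exact hμ A hA
  rw [← hh.integral_eq φ]
  conv_rhs => rw [← hmap]
  rw [integral_map measurable_inv.aemeasurable φ.continuous.stronglyMeasurable.aestronglyMeasurable,
    hh.integral_eq, ← integral_inv_eq_self (fun x => φ x * (h ∘ fun a => a⁻¹) x)]
  simp

theorem IsConvolution.density_apply {κ μ ν : Measure G} [IsFiniteMeasure κ] [IsFiniteMeasure μ]
    [IsFiniteMeasure ν] {l h m : G → ℝ} (hconv : IsConvolution κ μ ν)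
    (hl : HasHaarDensity κ l) (hh : HasHaarDensity μ h) (hm : HasHaarDensity ν m)
    (hlc : Continuous l) (hhc : Continuous h) (hmc : Continuous m) (x : G) :
    l x = ∫ y, h y * m (y⁻¹ * x) ∂(normalizedHaar G) := by
  refine Continuous.eq_of_forall_integral_mul_eq (ν := normalizedHaar G) hlc
    (continuous_integral_of_compactSpace (f := fun x y => h y * m (y⁻¹ * x)) (by fun_prop) _)
    (fun φ => ?_) x
  rw [← hl.integral_eq φ, hconv φ, hh.integral_eq]
  have inner (σ : G) : ∫ τ, φ (σ * τ) ∂ν = ∫ τ, φ τ * m (σ⁻¹ * τ) ∂(normalizedHaar G) := by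
    rw [hm.integral_eq, ← integral_mul_left_eq_self (fun τ => φ τ * m (σ⁻¹ * τ)) σ]
    simp
  simp_rw [inner, ← integral_mul_const, ← integral_const_mul]
  -- Fubini for continuous compactly supported integrands needs no second countability of `G`.
  rw [integral_integral_swap_of_hasCompactSupport (by fun_prop)
    (HasCompactSupport.of_compactSpace _)]
  exact integral_congr_ae (.of_forall fun _ => integral_congr_ae (.of_forall fun _ => by ring))

/-- The defect of a symmetric density `h` from invariance under translation by `c`, in terms of
its convolution square `l`. -/
theorem IsConvolution.integral_sq_sub {κ μ : Measure G} [IsFiniteMeasure κ] [IsFiniteMeasure μ]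
    {l h : G → ℝ} (hconv : IsConvolution κ μ μ) (hsymm : IsSymmetricMeasure μ)
    (hl : HasHaarDensity κ l) (hh : HasHaarDensity μ h)
    (hlc : Continuous l) (hhc : Continuous h) (c : G) :
    ∫ y, (h y - h (y⁻¹ * c)) ^ 2 ∂(normalizedHaar G) = 2 * (l 1 - l c) := by
  have hinv := hsymm.density_inv hh hhc
  have h1 : l 1 = ∫ y, h y ^ 2 ∂(normalizedHaar G) := by
    rw [hconv.density_apply hl hh hh hlc hhc hhc]
    simp [hinv, sq]
  have h2 : ∫ y, h (y⁻¹ * c) ^ 2 ∂(normalizedHaar G) = ∫ y, h y ^ 2 ∂(normalizedHaar G) := by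
    rw [integral_inv_eq_self (fun y => h (y * c) ^ 2) (normalizedHaar G),
      integral_mul_right_eq_self (fun y => h y ^ 2)]
  have i1 : Integrable (fun y => h y ^ 2) (normalizedHaar G) :=
    Continuous.integrable_of_compactSpace (by fun_prop) _
  have i2 : Integrable (fun y => h (y⁻¹ * c) ^ 2) (normalizedHaar G) :=
    Continuous.integrable_of_compactSpace (by fun_prop) _
  have i12 : Integrable (fun y => h y ^ 2 + h (y⁻¹ * c) ^ 2) (normalizedHaar G) :=
    Continuous.integrable_of_compactSpace (by fun_prop) _
  have i3 : Integrable (fun y => 2 * (h y * h (y⁻¹ * c))) (normalizedHaar G) :=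
    Continuous.integrable_of_compactSpace (by fun_prop) _
  have h3 : l c = ∫ y, h y * h (y⁻¹ * c) ∂(normalizedHaar G) :=
    hconv.density_apply hl hh hh hlc hhc hhc c
  calc ∫ y, (h y - h (y⁻¹ * c)) ^ 2 ∂(normalizedHaar G)
      = ∫ y, (h y ^ 2 + h (y⁻¹ * c) ^ 2) - 2 * (h y * h (y⁻¹ * c)) ∂(normalizedHaar G) :=
        integral_congr_ae (.of_forall fun y => by ring)
    _ = 2 * (l 1 - l c) := by
        rw [integral_sub i12 i3, integral_add i1 i2, h2, integral_const_mul, ← h1, ← h3]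
        ring

theorem IsConvolution.density_le {κ μ : Measure G} [IsFiniteMeasure κ] [IsFiniteMeasure μ]
    {l h : G → ℝ} (hconv : IsConvolution κ μ μ) (hsymm : IsSymmetricMeasure μ)
    (hl : HasHaarDensity κ l) (hh : HasHaarDensity μ h)
    (hlc : Continuous l) (hhc : Continuous h) (c : G) : l c ≤ l 1 := by
  have h1 := hconv.integral_sq_sub hsymm hl hh hlc hhc c
  have h2 : 0 ≤ ∫ y, (h y - h (y⁻¹ * c)) ^ 2 ∂(normalizedHaar G) :=
    integral_nonneg fun _ => sq_nonneg _
  linarith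

theorem IsConvolution.density_mul_right {κ μ : Measure G} [IsFiniteMeasure κ] [IsFiniteMeasure μ]
    {l h : G → ℝ} (hconv : IsConvolution κ μ μ) (hsymm : IsSymmetricMeasure μ)
    (hl : HasHaarDensity κ l) (hh : HasHaarDensity μ h)
    (hlc : Continuous l) (hhc : Continuous h) {c : G} (hc : l c = l 1) (x : G) :
    h (x * c) = h x := by
  have h1 := hconv.integral_sq_sub hsymm hl hh hlc hhc c
  rw [hc, sub_self, mul_zero] at h1
  -- At `y = x⁻¹` the integrand compares `h x⁻¹`, which is `h x` by symmetry, with `h (x * c)`.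
  have h2 := Continuous.eq_zero_of_integral_eq_zero
    (f := fun y => (h y - h (y⁻¹ * c)) ^ 2) ((hhc.sub (hhc.comp (continuous_inv.mul continuous_const))).pow 2)
    (fun _ => sq_nonneg _) h1 x⁻¹
  have h3 := sub_eq_zero.1 (pow_eq_zero_iff two_ne_zero |>.1 h2)
  rw [hsymm.density_inv hh hhc, inv_inv] at h3
  exact h3.symm

theorem HasHaarDensity.integral_mul_right {μ : Measure G} [IsFiniteMeasure μ] {h : G → ℝ}
    (hh : HasHaarDensity μ h) {c : G} (hc : ∀ x, h (x * c) = h x) (f : G → ℝ) :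
    ∫ x, f (x * c) ∂μ = ∫ x, f x ∂μ := by
  rw [hh.integral_eq, hh.integral_eq, ← integral_mul_right_eq_self (fun x => f x * h x) c]
  simp_rw [hc]

end Density

/-! ### Descent to time zero -/

section Semigroup

variable {G : Type*} [Group G] [TopologicalSpace G] [IsTopologicalGroup G]
  [CompactSpace G] [T2Space G] [MeasurableSpace G] [BorelSpace G]

theorem IsConvolutionSemigroup.eq_one_of_density_eq {μ : ℝ≥0 → ProbabilityMeasure G}
    (hμ : IsConvolutionSemigroup μ)
    (hsymm : ∀ t : ℝ≥0, 0 < t → IsSymmetricMeasure (μ t : Measure G)) {k : ℝ≥0 → G → ℝ}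
    (hdensity : ∀ t : ℝ≥0, 0 < t → HasHaarDensity (μ t : Measure G) (k t))
    (hcont : ∀ t : ℝ≥0, 0 < t → Continuous (k t)) {t : ℝ≥0} (ht : 0 < t) {c : G}
    (hc : k t c = k t 1) : c = 1 := by
  have step (s : ℝ≥0) (hs : 0 < s) (h : k s c = k s 1) (x : G) :
      k (s / 2) (x * c) = k (s / 2) x := by
    have hs2 : 0 < s / 2 := half_pos hs
    have hconv := hμ.add (s / 2) (s / 2)
    rw [add_halves] at hconv
    exact hconv.density_mul_right (hsymm _ hs2) (hdensity _ hs) (hdensity _ hs2) (hcont _ hs)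
      (hcont _ hs2) h x
  have hpos (n : ℕ) : 0 < t * (1 / 2) ^ n := by positivity
  have hhalf (n : ℕ) : t * (1 / 2) ^ n / 2 = t * (1 / 2) ^ (n + 1) := by
    rw [pow_succ, mul_one_div, mul_div_assoc]
  have hk (n : ℕ) : k (t * (1 / 2) ^ n) c = k (t * (1 / 2) ^ n) 1 := by
    induction n with
    | zero => simpa using hc
    -- Invariance of the halved-time density, read at `x = 1`, is the hypothesis for the next
    -- halving.
    | succ n ih => simpa only [hhalf, one_mul] using step _ (hpos n) ih 1
  have hinv (n : ℕ) (f : G → ℝ) : ∫ x, f (x * c) ∂(μ (t * (1 / 2) ^ (n + 1)) : Measure G)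
      = ∫ x, f x ∂(μ (t * (1 / 2) ^ (n + 1)) : Measure G) := by
    refine (hdensity _ (hpos _)).integral_mul_right (fun x => ?_) f
    simpa only [hhalf] using step _ (hpos n) (hk n) x
  have hlim : Tendsto (fun n : ℕ => t * (1 / 2) ^ (n + 1)) atTop (𝓝 0) := by
    have h2 : (1 / 2 : ℝ≥0) < 1 := by
      rw [← NNReal.coe_lt_coe]; norm_num
    have h := (NNReal.tendsto_pow_atTop_nhds_zero_of_lt_one h2).comp (tendsto_add_atTop_nat 1)
    simpa using h.const_mul t
  have hμlim := ProbabilityMeasure.tendsto_iff_forall_integral_tendsto.1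
    ((hμ.continuous.tendsto 0).comp hlim)
  simp only [hμ.zero, Function.comp_apply] at hμlim
  have hval (f : C(G, ℝ)) : f c = f 1 := by
    have h1 := hμlim (BoundedContinuousFunction.mkOfCompact f)
    have h2 := hμlim (BoundedContinuousFunction.mkOfCompact
      (f.comp ⟨fun x => x * c, continuous_mul_const c⟩))
    simp only [BoundedContinuousFunction.mkOfCompact_apply, ContinuousMap.comp_apply,
      ContinuousMap.coe_mk, hinv _ f] at h1 h2
    -- By invariance both limits are of the same sequence; under `δ_1` they are `f c` and `f 1`.
    have h3 := tendsto_nhds_unique h2 h1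
    rw [integral_dirac' _ _ (by
        exact ((f.continuous.comp (continuous_mul_const c)).stronglyMeasurable)),
      integral_dirac' _ _ (f.continuous.stronglyMeasurable)] at h3
    simpa using h3
  by_contra hne
  obtain ⟨f, hf0, hf1, -⟩ := exists_continuous_zero_one_of_isClosed (isClosed_singleton (x := c))
    (isClosed_singleton (x := (1 : G))) (by simpa using hne)
  have := hval f
  rw [hf0 rfl, hf1 rfl] at this
  simp at this

end Semigroup

theorem corollary5p7 {G : Type*} [Group G] [TopologicalSpace G] [IsTopologicalGroup G]
    [CompactSpace G] [T2Space G] [MeasurableSpace G] [BorelSpace G]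
    (μ : ℝ≥0 → ProbabilityMeasure G) (hμ : IsConvolutionSemigroup μ)
    (hcentral : ∀ t : ℝ≥0, 0 < t → IsCentralMeasure (μ t : Measure G))
    (hsymm : ∀ t : ℝ≥0, 0 < t → IsSymmetricMeasure (μ t : Measure G))
    (k : ℝ≥0 → G → ℝ)
    (hdensity : ∀ t : ℝ≥0, 0 < t → HasHaarDensity (μ t : Measure G) (k t))
    (hcont : ∀ t : ℝ≥0, 0 < t → Continuous (k t))
    (t : ℝ≥0) (ht : 0 < t) :
    (∫ ρ, ∫ g, k t (ρ⁻¹ * g * ρ * g⁻¹) ∂(normalizedHaar G) ∂(normalizedHaar G) ≤ k t 1) ∧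
      (k t 1 = ∫ ρ, ∫ g, k t (ρ⁻¹ * g * ρ * g⁻¹) ∂(normalizedHaar G) ∂(normalizedHaar G) ↔
        ∀ a b : G, a * b = b * a) := by
  have ht2 : 0 < t / 2 := half_pos ht
  have hconv := hμ.add (t / 2) (t / 2)
  rw [add_halves] at hconv
  have hle (c : G) : k t c ≤ k t 1 := hconv.density_le (hsymm _ ht2) (hdensity _ ht)
    (hdensity _ ht2) (hcont _ ht) (hcont _ ht2) c
  have hkc := hcont t ht
  have hc2 (ρ : G) : Continuous fun g => k t (ρ⁻¹ * g * ρ * g⁻¹) := by fun_prop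
  have hc1 : Continuous fun ρ => ∫ g, k t (ρ⁻¹ * g * ρ * g⁻¹) ∂(normalizedHaar G) :=
    continuous_integral_of_compactSpace (f := fun ρ g => k t (ρ⁻¹ * g * ρ * g⁻¹))
      (by fun_prop) _
  have hle1 (ρ : G) : ∫ g, k t (ρ⁻¹ * g * ρ * g⁻¹) ∂(normalizedHaar G) ≤ k t 1 :=
    (hc2 ρ).integral_le_of_le (fun _ => hle _) _
  refine ⟨hc1.integral_le_of_le hle1 _, fun h a b => ?_, fun h => ?_⟩
  -- Equality is peeled off one integral at a time: first in `ρ`, then in `g`.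
  · have h1 := hc1.eq_of_le_of_integral_eq hle1 h.symm b
    have h2 := (hc2 b).eq_of_le_of_integral_eq (fun _ => hle _) h1 a
    have h3 := hμ.eq_one_of_density_eq hsymm hdensity hcont ht h2
    rw [mul_inv_eq_one, mul_assoc, inv_mul_eq_iff_eq_mul] at h3
    exact h3
  · have (ρ g : G) : ρ⁻¹ * g * ρ * g⁻¹ = 1 := by
      rw [mul_inv_eq_one, mul_assoc, inv_mul_eq_iff_eq_mul, h]
    simp [this]
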